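/- **Theorem.** A *core* is a (finite, labelled, simple) graph in which every vertex has degree at least $2$; the empty graph is a core. Let $$\operatorname{Core}(z,w)=\sum_{G\text{ core}} w^{m(G)}\frac{z^{n(G)}}{n(G)!},$$ where $n(G)$ and $m(G)$ are the numbers of vertices and edges of $G$, and the sum is over all $n\ge 0$ and all cores with vertex set $\{1,\dots,n\}$. A *multigraph* has a finite set of labelled vertices and a finite set of edges, each edge being a triplet $(v,w,e)$ that consists of an origin $v$, an end $w$ (both vertices, possibly equal) and a label $e$; distinct edges have distinct labels. A *loop* of a multigraph is a subgraph $(\{v\},\{(v,v,e)\})$. A *double edge* is a subgraph $(\{v,w\},\{a,b\})$ with $v\ne w$, where $a,b$ are two edges with distinct labels, each of which links $v$ and $w$ in one of the two orientations. A *patchwork* is a finite set $P=\{(V_1,E_1),\dots,(V_p,E_p)\}$ of $p=|P|\ge 0$ distinct pairs such that $\operatorname{MG}(P)=(\bigcup_i V_i,\bigcup_i E_i)$ is a multigraph and each $(V_i,E_i)$ is a loop or a double edge of $\operatorname{MG}(P)$. Let $n(P)$ and $m(P)$ be the numbers of vertices and edges of $\operatorname{MG}(P)$, and let $$P(z,w,u)=\sum_{P\text{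 patchwork}}u^{|P|}\,\frac{w^{m(P)}}{2^{m(P)}\,m(P)!}\,\frac{z^{n(P)}}{n(P)!},$$ where the sum is over the patchworks $P$ such that the vertex labels of $\operatorname{MG}(P)$ are exactly $1,\dots,n(P)$ and its edge labels are exactly $1,\dots,m(P)$. This is a formal power series in $z,w$ whose coefficients are polynomials in $u$. Then, as formal power series in $z$ and $w$ with rational coefficients, $$\operatorname{Core}(z,w)=\sum_{m\ge 0}(2m)!\,\Big([x^{2m}]\,P(z e^x,w,-1)\,e^{z(e^x-1-x)}\Big)\frac{w^m}{2^m\,m!},$$ where, for each pair $(i,j)$, only finitely many terms of the sum over $m$ contribute to the coefficient of $z^iw^j$. -/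

import Mathlib

noncomputable section

namespace CoreEnum

/-! ### Simple graphs and cores -/

/-- The generating function `∑_{G ∈ F} w^{m(G)} z^{n(G)} / n(G)!` of a family `F` of labelled
simple graphs, as a formal power series in `z = X 0` and `w = X 1`.  The vertex labels of a
graph with `n` vertices are the elements of `Fin n`. -/
def graphGF (F : ∀ n : ℕ, Set (SimpleGraph (Fin n))) : MvPowerSeries (Fin 2) ℚ := fun d =>
  (Set.ncard {G : SimpleGraph (Fin (d 0)) | G ∈ F (d 0) ∧ G.edgeSet.ncard = d 1} : ℚ) /
    (d 0).factorial

/-- The cores on `n` labelled vertices: the simple graphs in which every vertex has degree at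
least `2` (the graph without vertices is a core). -/
def cores (n : ℕ) : Set (SimpleGraph (Fin n)) :=
  {G | ∀ v, 2 ≤ (G.neighborSet v).ncard}

/-- The generating function `Core(z, w)` of cores. -/
def coreGF : MvPowerSeries (Fin 2) ℚ := graphGF cores

/-! ### Multigraphs -/

/-- A multigraph with vertex labels in `α` and edge labels in `β`.  An edge is a triplet
`(v, w, e)`, oriented from `v` to `w` and labelled `e`; loops and multiple edges are allowed,
and distinct edges have distinct labels. -/
structure Multigraph (α β : Type*) where
  vertices : Finset α
  edges : Finset (α × α × β)
  left_mem : ∀ a ∈ edges, a.1 ∈ vertices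
  right_mem : ∀ a ∈ edges, a.2.1 ∈ vertices
  label_injOn : ∀ a ∈ edges, ∀ b ∈ edges, a.2.2 = b.2.2 → a = b

/-- A pair (set of vertices, set of edges). -/
abbrev Part (α β : Type*) := Finset α × Finset (α × α × β)

section

variable {α β : Type*} [DecidableEq α] [DecidableEq β]

/-- One vertex `v` and one edge, from `v` to `v`. -/
def Part.IsLoop (s : Part α β) : Prop :=
  ∃ (v : α) (e : β), s = ({v}, {(v, v, e)})

/-- Two distinct vertices `v`, `w` and two edges with distinct labels, each of them linking `v`
and `w`, in either orientation. -/
def Part.IsDoubleEdge (s : Part α β) : Prop :=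
  ∃ (v w : α) (e f : β) (a b : α × α × β), v ≠ w ∧ e ≠ f ∧
    (a = (v, w, e) ∨ a = (w, v, e)) ∧ (b = (v, w, f) ∨ b = (w, v, f)) ∧
    s = ({v, w}, {a, b})

/-- The set `LD(G)` of loops and double edges of the multigraph `G`. -/
def Multigraph.LD (G : Multigraph α β) : Set (Part α β) :=
  {s | s.1 ⊆ G.vertices ∧ s.2 ⊆ G.edges ∧ (s.IsLoop ∨ s.IsDoubleEdge)}

/-- `IsMG P G` means that `G` is `MG(P)`: its vertices and its edges are the unions of those of
the members of `P`. -/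
def IsMG (P : Finset (Part α β)) (G : Multigraph α β) : Prop :=
  G.vertices = P.biUnion Prod.fst ∧ G.edges = P.biUnion Prod.snd

/-- A patchwork is a set `P` of pairs (vertices, edges) such that `MG(P)` is a multigraph and
every member of `P` is a loop or a double edge of it. -/
def IsPatchwork (P : Finset (Part α β)) : Prop :=
  ∃ G : Multigraph α β, IsMG P G ∧ ∀ s ∈ P, s ∈ G.LD

end

/-- The patchworks with exactly `n` vertices, labelled by `Fin n`, and exactly `m` edges,
labelled by `Fin m`: every vertex label and every edge label is used. -/
def patchworks (n m : ℕ) : Set (Finset (Part (Fin n) (Fin m))) :=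
  {P | IsPatchwork P ∧ P.biUnion Prod.fst = Finset.univ ∧
    (P.biUnion Prod.snd).image (fun a => a.2.2) = Finset.univ}

open Classical in
/-- The generating function
`P(z, w, u) = ∑_P u^{|P|} (w^{m(P)} / (2^{m(P)} m(P)!)) (z^{n(P)} / n(P)!)` of patchworks, as a
formal power series in `z = X 0` and `w = X 1` whose coefficients are polynomials in `u`. -/
def patchworkGF : MvPowerSeries (Fin 2) (Polynomial ℚ) := fun d =>
  ∑ P : Finset (Part (Fin (d 0)) (Fin (d 1))) with P ∈ patchworks (d 0) (d 1),
    Polynomial.C (1 / ((2 : ℚ) ^ d 1 * (d 1).factorial * (d 0).factorial)) *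
      Polynomial.X ^ P.card

/-- The series `P(z, w, c)` for a rational number `c`. -/
def patchworkGFAt (c : ℚ) : MvPowerSeries (Fin 2) ℚ :=
  MvPowerSeries.map (Polynomial.evalRingHom c) patchworkGF

/-! ### Formal power series in `x`, `z`, `w` -/

/-- The variable `x` of `ℚ⟦x, z, w⟧`. -/
def xVar : MvPowerSeries (Fin 3) ℚ := MvPowerSeries.X 0

/-- The variable `z` of `ℚ⟦x, z, w⟧`. -/
def zVar : MvPowerSeries (Fin 3) ℚ := MvPowerSeries.X 1

/-- The variable `w` of `ℚ⟦x, z, w⟧`. -/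
def wVar : MvPowerSeries (Fin 3) ℚ := MvPowerSeries.X 2

/-- The exponential `e^f` of a formal power series `f` without constant term. -/
def expSeries (f : MvPowerSeries (Fin 3) ℚ) : MvPowerSeries (Fin 3) ℚ :=
  (PowerSeries.exp ℚ).subst f

/-- The coefficient `[x^k] F`, a formal power series in `z = X 0` and `w = X 1`. -/
def coeffX (k : ℕ) (F : MvPowerSeries (Fin 3) ℚ) : MvPowerSeries (Fin 2) ℚ := fun d =>
  MvPowerSeries.coeff (Finsupp.cons k d) F

/-- The series `P(z e^x, w, -1) e^{z (e^x - 1 - x)}`. -/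
def coreIntegrand : MvPowerSeries (Fin 3) ℚ :=
  MvPowerSeries.subst ![zVar * expSeries xVar, wVar] (patchworkGFAt (-1)) *
    expSeries (zVar * (expSeries xVar - 1 - xVar))

/-- `s = ∑_{m ≥ 0} f m` as formal power series: each coefficient vanishes in all but finitely many
of the `f m`, and its sum over `m` is the coefficient of `s`.  This is convergence in the
product topology with discrete coefficients. -/
def HasFormalSum (f : ℕ → MvPowerSeries (Fin 2) ℚ) (s : MvPowerSeries (Fin 2) ℚ) : Prop :=
  ∀ d : Fin 2 →₀ ℕ, (Function.support fun m => MvPowerSeries.coeff d (f m)).Finite ∧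
    ∑ᶠ m, MvPowerSeries.coeff d (f m) = MvPowerSeries.coeff d s

end CoreEnum

end

noncomputable section

namespace CoreEnum

/-! ### Exponential generating functions of maps with prescribed fibre sizes -/

/-! Fix `i` vertices and `j` edge labels. A map `f : Fin j × Bool → Fin i` on half-edges is a
multigraph with labelled, oriented edges, and the degree of a vertex is the size of its fibre.
Ordering and orienting the edges of a core in all `2 ^ j * j!` ways gives exactly the maps of
minimal degree two without loops or double edges (`card_simple_minDegTwo_eq`).

Loops and double edges are removed by inclusion-exclusion: the indicator of `LD = ∅` is the sum of
`(-1) ^ |P|` over the subsets `P` of `LD`, and these `P` are patchworks. After exchanging the sums,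
fix a patchwork `P` with `a` vertices and `k` edge labels. Its edges are forced, and its vertices
already have degree two, so `f` amounts to a map on the other `2 (j - k)` half-edges whose fibres
off the `a` vertices have at least two elements (`card_completions`). There are `(2m)! [x^{2m}]
e^{ax} (e^x - 1 - x)^{i-a}` of these, with `m = j - k` (`card_two_le_fiber`).

The signed number of patchworks on given vertex and label sets depends only on `a` and `k`
(`sum_patchwork_eq_patchworkSum`), so binomial coefficients count the choices of these sets.
Division by `2 ^ j * j! * i!` turns the result into the coefficient of `z^i w^j` of the series
(`slice_coreIntegrand`, `sum_coeff_summand`): `m` counts the edges off the patchwork, and `z e^x`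
records that its vertices may receive any number of further half-edges. -/

theorem derivative_prod {ι : Type*} [DecidableEq ι] (s : Finset ι) (f : ι → PowerSeries ℚ) :
    PowerSeries.derivative ℚ (∏ i ∈ s, f i) =
      ∑ i ∈ s, PowerSeries.derivative ℚ (f i) * ∏ j ∈ s.erase i, f j := by
  induction s using Finset.induction_on with
  | empty => simp
  | insert a s ha ih =>
    rw [Finset.prod_insert ha, Derivation.leibniz, ih, Finset.sum_insert ha,
      Finset.erase_insert ha, smul_eq_mul, smul_eq_mul, add_comm, Finset.mul_sum, mul_comm]
    congr 1
    refine Finset.sum_congr rfl fun i hi => ?_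
    have hia : a ≠ i := fun h => ha (h ▸ hi)
    rw [Finset.erase_insert_of_ne hia, Finset.prod_insert (fun h => ha (Finset.mem_of_mem_erase h))]
    ring

/-- The exponential generating function of a sequence. -/
def egf (c : ℕ → ℚ) : PowerSeries ℚ := PowerSeries.mk fun k => c k / k.factorial

theorem derivative_egf (c : ℕ → ℚ) :
    PowerSeries.derivative ℚ (egf c) = egf fun k => c (k + 1) := by
  ext k
  have hk : (k.factorial : ℚ) ≠ 0 := by positivity
  have hk' : (k + 1 : ℚ) ≠ 0 := by positivity
  simp only [egf, PowerSeries.coeff_derivative, PowerSeries.coeff_mk, Nat.factorial_succ]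
  push_cast
  field_simp

/-- Induction on `n`: sending the point `0` to `u` shifts the weight sequence of `u` by one. A shift
differentiates the exponential generating function, so summing over `u` is the Leibniz rule for the
product. -/
theorem sum_prod_card_fiber_fin {α : Type*} [Fintype α] [DecidableEq α] (n : ℕ)
    (c : α → ℕ → ℚ) :
    ∑ f : Fin n → α, ∏ v, c v (Finset.card {x | f x = v}) =
      n.factorial * PowerSeries.coeff n (∏ v, egf (c v)) := by
  induction n generalizing c with
  | zero =>
    simp [egf, map_prod]
  | succ n ih =>
    have hcons : ∀ (u : α) (f : Fin n → α),
        ∏ v, c v (Finset.card {x | (Fin.cons u f : Fin (n + 1) → α) x = v}) =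
          ∏ v, (Function.update c u fun k => c u (k + 1)) v (Finset.card {x | f x = v}) := by
      intro u f
      refine Finset.prod_congr rfl fun v _ => ?_
      rw [Fin.card_filter_univ_succ]
      rcases eq_or_ne u v with rfl | h
      · simp [add_comm]
      · simp [h, Function.update_of_ne h.symm]
    rw [← (Fin.consEquiv fun _ => α).sum_comp, Fintype.sum_prod_type]
    simp only [Fin.consEquiv_apply, hcons, ih]
    rw [← Finset.mul_sum, ← map_sum, Nat.factorial_succ, Nat.cast_mul, mul_comm ((n + 1 : ℕ) : ℚ),
      mul_assoc, Nat.cast_succ, mul_comm ((n : ℚ) + 1), ← PowerSeries.coeff_derivative,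
      derivative_prod]
    congr 2
    refine Finset.sum_congr rfl fun u _ => ?_
    rw [← Finset.mul_prod_erase _ _ (Finset.mem_univ u), derivative_egf, Function.update_self]
    congr 1
    refine Finset.prod_congr rfl fun v hv => ?_
    rw [Function.update_of_ne (Finset.ne_of_mem_erase hv)]

theorem sum_prod_card_fiber {X α : Type*} [Fintype X] [DecidableEq X] [Fintype α] [DecidableEq α]
    (c : α → ℕ → ℚ) :
    ∑ f : X → α, ∏ v, c v (Finset.card {x | f x = v}) =
      (Fintype.card X).factorial * PowerSeries.coeff (Fintype.card X) (∏ v, egf (c v)) := by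
  rw [← sum_prod_card_fiber_fin,
    ← ((Fintype.equivFin X).arrowCongr (Equiv.refl α)).sum_comp]
  refine Finset.sum_congr rfl fun f _ => Finset.prod_congr rfl fun v _ => ?_
  congr 1
  exact Finset.card_equiv (Fintype.equivFin X) (by simp)

theorem egf_one : egf (fun _ => 1) = PowerSeries.exp ℚ := by
  ext k
  simp [egf, PowerSeries.coeff_exp]

theorem egf_two_le :
    egf (fun k => if 2 ≤ k then 1 else 0) = PowerSeries.exp ℚ - 1 - PowerSeries.X := by
  ext k
  rcases k with _ | _ | k
  · simp [egf]
  · simp [egf, PowerSeries.coeff_exp, PowerSeries.coeff_one]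
  · simp [egf, PowerSeries.coeff_exp, PowerSeries.coeff_one, PowerSeries.coeff_X]

/-- Maps all of whose fibres off `A` have at least two elements are counted by
`e^{|A| x} (e^x - 1 - x)^{|Aᶜ|}`. -/
theorem card_two_le_fiber {X α : Type*} [Fintype X] [DecidableEq X] [Fintype α] [DecidableEq α]
    (A : Finset α) :
    (Finset.card {f : X → α | ∀ v ∉ A, 2 ≤ Finset.card {x | f x = v}} : ℚ) =
      (Fintype.card X).factorial * PowerSeries.coeff (Fintype.card X)
        (PowerSeries.exp ℚ ^ A.card *
          (PowerSeries.exp ℚ - 1 - PowerSeries.X) ^ (Fintype.card α - A.card)) := by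
  have h := sum_prod_card_fiber (X := X)
    (fun (v : α) k => if v ∈ A then (1 : ℚ) else if 2 ≤ k then 1 else 0)
  have hprod : ∏ v, egf (fun k => if v ∈ A then (1 : ℚ) else if 2 ≤ k then 1 else 0) =
      PowerSeries.exp ℚ ^ A.card *
        (PowerSeries.exp ℚ - 1 - PowerSeries.X) ^ (Fintype.card α - A.card) := by
    rw [← Finset.card_compl, ← Finset.prod_mul_prod_compl A]
    congr 1
    · refine Finset.prod_eq_pow_card fun v hv => ?_
      simp only [hv, if_true, egf_one]
    · refine Finset.prod_eq_pow_card fun v hv => ?_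
      simp only [Finset.mem_compl.1 hv, if_false, egf_two_le]
  rw [hprod] at h
  rw [← h, Finset.card_filter, Nat.cast_sum]
  refine Finset.sum_congr rfl fun f _ => ?_
  by_cases hf : ∀ v ∉ A, 2 ≤ Finset.card {x | f x = v}
  · rw [if_pos hf, Finset.prod_eq_one]
    · simp
    · intro v _
      by_cases hv : v ∈ A
      · simp [hv]
      · simp [hf v hv]
  · rw [if_neg hf]
    push Not at hf
    obtain ⟨v, hv, hlt⟩ := hf
    rw [Finset.prod_eq_zero (Finset.mem_univ v)]
    · simp
    · simp [hv, hlt]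

/-! ### Coefficients of the integrand -/

/-- The exponent of the monomial `z^a w^b`. -/
def expo (a b : ℕ) : Fin 2 →₀ ℕ := Finsupp.equivFunOnFinite.symm ![a, b]

@[simp] theorem expo_zero (a b : ℕ) : expo a b 0 = a := rfl

@[simp] theorem expo_one (a b : ℕ) : expo a b 1 = b := rfl

theorem eq_expo (d : Fin 2 →₀ ℕ) : d = expo (d 0) (d 1) := by
  ext i
  fin_cases i <;> rfl

theorem expo_inj {a b a' b' : ℕ} : expo a b = expo a' b' ↔ a = a' ∧ b = b' := by
  refine ⟨fun h => ⟨?_, ?_⟩, by rintro ⟨rfl, rfl⟩; rfl⟩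
  · simpa using DFunLike.congr_fun h 0
  · simpa using DFunLike.congr_fun h 1

theorem sum_antidiagonal_expo {M : Type*} [AddCommMonoid M] (i j : ℕ)
    (f : (Fin 2 →₀ ℕ) × (Fin 2 →₀ ℕ) → M) :
    ∑ p ∈ Finset.HasAntidiagonal.antidiagonal (expo i j), f p =
      ∑ q ∈ Finset.HasAntidiagonal.antidiagonal i, ∑ r ∈ Finset.HasAntidiagonal.antidiagonal j,
        f (expo q.1 r.1, expo q.2 r.2) := by
  rw [← Finset.sum_product']
  refine Finset.sum_bij' (fun p _ => ((p.1 0, p.2 0), (p.1 1, p.2 1)))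
    (fun x _ => (expo x.1.1 x.2.1, expo x.1.2 x.2.2)) ?_ ?_ ?_ ?_ ?_
  · intro p hp
    rw [Finset.HasAntidiagonal.mem_antidiagonal] at hp
    simp only [Finset.mem_product, Finset.HasAntidiagonal.mem_antidiagonal]
    exact ⟨by simpa using DFunLike.congr_fun hp 0, by simpa using DFunLike.congr_fun hp 1⟩
  · intro x hx
    simp only [Finset.mem_product, Finset.HasAntidiagonal.mem_antidiagonal] at hx ⊢
    ext k
    fin_cases k
    · simpa using hx.1
    · simpa using hx.2
  · intro p _
    simp [← eq_expo]
  · intro x _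
    simp
  · intro p _
    simp [← eq_expo]

/-- The coefficient of `z^{d 0} w^{d 1}`, a power series in `x`. -/
def slice (F : MvPowerSeries (Fin 3) ℚ) (d : Fin 2 →₀ ℕ) : PowerSeries ℚ :=
  PowerSeries.mk fun n => MvPowerSeries.coeff (Finsupp.cons n d) F

theorem coeff_slice (F : MvPowerSeries (Fin 3) ℚ) (d : Fin 2 →₀ ℕ) (n : ℕ) :
    PowerSeries.coeff n (slice F d) = MvPowerSeries.coeff (Finsupp.cons n d) F :=
  PowerSeries.coeff_mk _ _

theorem cons_add_cons {k : ℕ} (a b : ℕ) (d e : Fin k →₀ ℕ) :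
    Finsupp.cons a d + Finsupp.cons b e = Finsupp.cons (a + b) (d + e) := by
  ext i
  refine Fin.cases ?_ (fun i => ?_) i <;> simp

theorem slice_mul (F G : MvPowerSeries (Fin 3) ℚ) (d : Fin 2 →₀ ℕ) :
    slice (F * G) d = ∑ p ∈ Finset.HasAntidiagonal.antidiagonal d, slice F p.1 * slice G p.2 := by
  ext n
  simp only [coeff_slice, map_sum, PowerSeries.coeff_mul, MvPowerSeries.coeff_mul]
  -- A splitting of the exponent `cons n d` is a splitting of `n` together with one of `d`.
  rw [Finset.sum_comm, ← Finset.sum_product']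
  refine Finset.sum_bij' (fun p _ => ((p.1 0, p.2 0), (p.1.tail, p.2.tail)))
    (fun x _ => (Finsupp.cons x.1.1 x.2.1, Finsupp.cons x.1.2 x.2.2)) ?_ ?_ ?_ ?_ ?_
  · intro p hp
    rw [Finset.HasAntidiagonal.mem_antidiagonal] at hp
    simp only [Finset.mem_product, Finset.HasAntidiagonal.mem_antidiagonal]
    refine ⟨by simpa using DFunLike.congr_fun hp 0, ?_⟩
    ext k
    simpa [Finsupp.tail_apply] using DFunLike.congr_fun hp k.succ
  · intro x hx
    simp only [Finset.mem_product, Finset.HasAntidiagonal.mem_antidiagonal] at hx ⊢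
    rw [cons_add_cons, hx.1, hx.2]
  · intro p _
    simp
  · intro x _
    simp
  · intro p _
    simp

theorem hasSubst_x : PowerSeries.HasSubst xVar := PowerSeries.HasSubst.X 0

/-- Both substitutions in the integrand expand into terms of this shape, a series in `x` times a
monomial in `z` and `w`. -/
theorem slice_subst_x_mul (f : PowerSeries ℚ) (a b : ℕ) (d : Fin 2 →₀ ℕ) :
    slice (f.subst xVar * (zVar ^ a * wVar ^ b)) d = if d = expo a b then f else 0 := by
  ext n
  have hmon : zVar ^ a * wVar ^ b = MvPowerSeries.monomial (Finsupp.cons 0 (expo a b)) (1 : ℚ) := by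
    rw [zVar, wVar, MvPowerSeries.X_pow_eq, MvPowerSeries.X_pow_eq,
      MvPowerSeries.monomial_mul_monomial, one_mul]
    refine congrArg (fun e : Fin 3 →₀ ℕ => MvPowerSeries.monomial e (1 : ℚ)) ?_
    ext i
    fin_cases i
    · simp
    · simp
      rfl
    · simp
      rfl
  rw [coeff_slice, hmon, MvPowerSeries.coeff_mul_monomial, mul_one]
  by_cases hd : d = expo a b
  · subst hd
    have hle : (Finsupp.cons 0 (expo a b) : Fin 3 →₀ ℕ) ≤ Finsupp.cons n (expo a b) := by
      intro i
      refine Fin.cases ?_ (fun i => ?_) i <;> simp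
    have hsub : (Finsupp.cons n (expo a b) - Finsupp.cons 0 (expo a b) : Fin 3 →₀ ℕ) =
        Finsupp.single 0 n := by
      ext i
      refine Fin.cases ?_ (fun i => ?_) i <;> simp
    rw [if_pos hle, if_pos rfl, hsub, xVar, PowerSeries.coeff_subst_single]
    simp
  · rw [if_neg hd, map_zero]
    split_ifs with hle
    · rw [xVar, PowerSeries.coeff_subst_single, if_neg]
      intro h
      apply hd
      ext i
      have h1 := DFunLike.congr_fun h i.succ
      have h2 := hle i.succ
      simp at h1 h2
      omega
    · rfl

theorem expSeries_x_pow (a : ℕ) :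
    expSeries xVar ^ a = (PowerSeries.exp ℚ ^ a).subst xVar := by
  rw [PowerSeries.subst_pow hasSubst_x, expSeries]

theorem constantCoeff_zVar : MvPowerSeries.constantCoeff zVar = 0 :=
  MvPowerSeries.constantCoeff_X _

theorem slice_subst (p : MvPowerSeries (Fin 2) ℚ) (d : Fin 2 →₀ ℕ) :
    slice (MvPowerSeries.subst ![zVar * expSeries xVar, wVar] p) d =
      MvPowerSeries.coeff d p • PowerSeries.exp ℚ ^ d 0 := by
  have hs : MvPowerSeries.HasSubst ![zVar * expSeries xVar, wVar] := by
    refine MvPowerSeries.hasSubst_of_constantCoeff_zero fun i => ?_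
    fin_cases i
    · simp [constantCoeff_zVar]
    · simp [wVar]
  have key : ∀ e : Fin 2 →₀ ℕ, ∀ n, MvPowerSeries.coeff (Finsupp.cons n d)
      (e.prod fun s k => ![zVar * expSeries xVar, wVar] s ^ k) =
      if d = e then PowerSeries.coeff n (PowerSeries.exp ℚ ^ e 0) else 0 := by
    intro e n
    have : (e.prod fun s k => ![zVar * expSeries xVar, wVar] s ^ k) =
        (PowerSeries.exp ℚ ^ e 0).subst xVar * (zVar ^ e 0 * wVar ^ e 1) := by
      rw [Finsupp.prod_fintype _ _ (by simp), Fin.prod_univ_two, ← expSeries_x_pow]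
      simp only [Matrix.cons_val_zero, Matrix.cons_val_one]
      ring
    rw [this, ← coeff_slice, slice_subst_x_mul, ← eq_expo]
    split_ifs <;> simp
  ext n
  -- The substitution sends `z^a w^b` to `z^a w^b e^{ax}`, so only the monomial `d` of `p`
  -- contributes.
  rw [coeff_slice, MvPowerSeries.coeff_subst hs, finsum_eq_single _ d]
  · rw [key, if_pos rfl, PowerSeries.coeff_smul, smul_eq_mul]
  · intro e he
    rw [key, if_neg he.symm, smul_zero]

theorem slice_exp (D : PowerSeries ℚ) (d : Fin 2 →₀ ℕ) :
    slice (expSeries (zVar * D.subst xVar)) d =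
      if d 1 = 0 then (1 / (d 0).factorial : ℚ) • D ^ d 0 else 0 := by
  have hs : PowerSeries.HasSubst (zVar * D.subst xVar) :=
    PowerSeries.HasSubst.of_constantCoeff_zero (by simp [constantCoeff_zVar])
  have key : ∀ k n, MvPowerSeries.coeff (Finsupp.cons n d) ((zVar * D.subst xVar) ^ k) =
      if d = expo k 0 then PowerSeries.coeff n (D ^ k) else 0 := by
    intro k n
    have : (zVar * D.subst xVar) ^ k = (D ^ k).subst xVar * (zVar ^ k * wVar ^ 0) := by
      rw [PowerSeries.subst_pow hasSubst_x]
      ring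
    rw [this, ← coeff_slice, slice_subst_x_mul]
    split_ifs <;> simp
  ext n
  rw [coeff_slice, expSeries, PowerSeries.coeff_subst hs, finsum_eq_single _ (d 0)]
  · rw [key]
    conv_lhs => rw [eq_expo d]
    simp only [expo_inj, expo_zero, true_and, PowerSeries.coeff_exp]
    split_ifs <;> simp
  · intro k hk
    rw [key, if_neg, smul_zero]
    intro h
    exact hk (by rw [h, expo_zero])

theorem slice_coreIntegrand (i k : ℕ) :
    slice coreIntegrand (expo i k) =
      ∑ q ∈ Finset.HasAntidiagonal.antidiagonal i, (MvPowerSeries.coeff (expo q.1 k) (patchworkGFAt (-1)) /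
        q.2.factorial) • (PowerSeries.exp ℚ ^ q.1 *
          (PowerSeries.exp ℚ - 1 - PowerSeries.X) ^ q.2) := by
  have hD : expSeries xVar - 1 - xVar =
      (PowerSeries.exp ℚ - 1 - PowerSeries.X : PowerSeries ℚ).subst xVar := by
    rw [PowerSeries.subst_sub hasSubst_x, PowerSeries.subst_sub hasSubst_x,
      PowerSeries.subst_X hasSubst_x, expSeries, ← PowerSeries.coe_substAlgHom hasSubst_x, map_one]
  rw [coreIntegrand, hD, slice_mul, sum_antidiagonal_expo]
  refine Finset.sum_congr rfl fun q _ => ?_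
  -- The exponential factor is free of `w`, so all of `w^k` comes from the patchwork factor.
  rw [Finset.sum_eq_single (k, 0)]
  · rw [slice_subst, slice_exp]
    simp only [expo_zero, expo_one, if_true]
    rw [smul_mul_smul_comm, mul_one_div]
  · intro r hr hne
    rw [slice_exp, if_neg, mul_zero]
    intro h
    rw [Finset.HasAntidiagonal.mem_antidiagonal] at hr
    simp only [expo_one] at h
    exact hne (Prod.ext (by simp; omega) h)
  · intro h
    simp at h

/-! ### Patchworks and their relabellings -/

section Patchworks

set_option linter.unusedSectionVars false

variable {α β α' β' : Type*} [DecidableEq α] [DecidableEq β] [DecidableEq α'] [DecidableEq β']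

/-- The vertices of a set of parts. -/
def verts (P : Finset (Part α β)) : Finset α := P.biUnion Prod.fst

/-- The edges of a set of parts. -/
def edgs (P : Finset (Part α β)) : Finset (α × α × β) := P.biUnion Prod.snd

/-- The edge labels of a set of parts. -/
def labels (P : Finset (Part α β)) : Finset β := (edgs P).image fun a => a.2.2

theorem ends_mem {s : Part α β} (hs : s.IsLoop ∨ s.IsDoubleEdge) {a : α × α × β}
    (ha : a ∈ s.2) : a.1 ∈ s.1 ∧ a.2.1 ∈ s.1 := by
  rcases hs with ⟨v, e, rfl⟩ | ⟨v, w, e, f, a', b', -, -, h1, h2, rfl⟩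
  · simp only [Finset.mem_singleton] at ha
    subst ha
    simp
  · simp only [Finset.mem_insert, Finset.mem_singleton] at ha
    rcases ha with rfl | rfl
    · rcases h1 with rfl | rfl <;> simp
    · rcases h2 with rfl | rfl <;> simp

/-- The ends of an edge of a loop or double edge are vertices of that part, so the unions form a
multigraph as soon as edge labels determine edges. -/
theorem isPatchwork_iff {P : Finset (Part α β)} :
    IsPatchwork P ↔ (∀ s ∈ P, s.IsLoop ∨ s.IsDoubleEdge) ∧
      ∀ a ∈ edgs P, ∀ b ∈ edgs P, a.2.2 = b.2.2 → a = b := by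
  constructor
  · rintro ⟨G, ⟨-, hE⟩, hP⟩
    refine ⟨fun s hs => (hP s hs).2.2, ?_⟩
    rw [edgs, ← hE]
    exact G.label_injOn
  · rintro ⟨h1, h2⟩
    have hends : ∀ a ∈ edgs P, a.1 ∈ verts P ∧ a.2.1 ∈ verts P := by
      intro a ha
      obtain ⟨s, hs, has⟩ := Finset.mem_biUnion.1 ha
      exact ⟨Finset.mem_biUnion.2 ⟨s, hs, (ends_mem (h1 s hs) has).1⟩,
        Finset.mem_biUnion.2 ⟨s, hs, (ends_mem (h1 s hs) has).2⟩⟩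
    refine ⟨⟨verts P, edgs P, fun a ha => (hends a ha).1, fun a ha => (hends a ha).2, h2⟩,
      ⟨rfl, rfl⟩, fun s hs => ⟨?_, ?_, h1 s hs⟩⟩
    · exact Finset.subset_biUnion_of_mem Prod.fst hs
    · exact Finset.subset_biUnion_of_mem Prod.snd hs

/-- Relabelling of edges. -/
def edgeMap (φ : α' ↪ α) (ψ : β' ↪ β) : α' × α' × β' ↪ α × α × β := φ.prodMap (φ.prodMap ψ)

/-- Relabelling of parts. -/
def partMap (φ : α' ↪ α) (ψ : β' ↪ β) : Part α' β' ↪ Part α β :=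
  (Finset.mapEmbedding φ).toEmbedding.prodMap (Finset.mapEmbedding (edgeMap φ ψ)).toEmbedding

variable (φ : α' ↪ α) (ψ : β' ↪ β)

@[simp] theorem edgeMap_apply (a : α' × α' × β') :
    edgeMap φ ψ a = (φ a.1, φ a.2.1, ψ a.2.2) := rfl

theorem partMap_apply (s : Part α' β') :
    partMap φ ψ s = (s.1.map φ, s.2.map (edgeMap φ ψ)) := rfl

theorem Part.IsLoop.partMap {s : Part α' β'} (h : s.IsLoop) :
    (partMap φ ψ s).IsLoop := by
  obtain ⟨v, e, rfl⟩ := h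
  exact ⟨φ v, ψ e, by simp [partMap_apply]⟩

theorem Part.IsDoubleEdge.partMap {s : Part α' β'} (h : s.IsDoubleEdge) :
    (partMap φ ψ s).IsDoubleEdge := by
  obtain ⟨v, w, e, f, a, b, hvw, hef, ha, hb, rfl⟩ := h
  refine ⟨φ v, φ w, ψ e, ψ f, edgeMap φ ψ a, edgeMap φ ψ b, φ.injective.ne hvw,
    ψ.injective.ne hef, ?_, ?_, by simp [partMap_apply, Finset.map_insert]⟩
  · rcases ha with rfl | rfl <;> simp
  · rcases hb with rfl | rfl <;> simp

theorem exists_partMap_eq {s : Part α β} (hs : s.IsLoop ∨ s.IsDoubleEdge)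
    (hV : ∀ v ∈ s.1, v ∈ Set.range φ) (hL : ∀ a ∈ s.2, a.2.2 ∈ Set.range ψ) :
    ∃ s' : Part α' β', partMap φ ψ s' = s ∧ (s'.IsLoop ∨ s'.IsDoubleEdge) := by
  rcases hs with ⟨v, e, rfl⟩ | ⟨v, w, e, f, a, b, hvw, hef, ha, hb, rfl⟩
  · obtain ⟨v, rfl⟩ := hV v (by simp)
    obtain ⟨e, rfl⟩ := hL (_, _, e) (Finset.mem_singleton_self _)
    exact ⟨({v}, {(v, v, e)}), by simp [partMap_apply], Or.inl ⟨v, e, rfl⟩⟩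
  · obtain ⟨v, rfl⟩ := hV v (by simp)
    obtain ⟨w, rfl⟩ := hV w (by simp)
    have he : e ∈ Set.range ψ := by
      have := hL a (by simp)
      rcases ha with rfl | rfl <;> exact this
    have hf : f ∈ Set.range ψ := by
      have := hL b (by simp)
      rcases hb with rfl | rfl <;> exact this
    obtain ⟨e, rfl⟩ := he
    obtain ⟨f, rfl⟩ := hf
    have hvw' : v ≠ w := fun h => hvw (h ▸ rfl)
    have hef' : e ≠ f := fun h => hef (h ▸ rfl)
    have ha' : ∃ a', edgeMap φ ψ a' = a ∧ (a' = (v, w, e) ∨ a' = (w, v, e)) := by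
      rcases ha with rfl | rfl
      · exact ⟨(v, w, e), rfl, Or.inl rfl⟩
      · exact ⟨(w, v, e), rfl, Or.inr rfl⟩
    have hb' : ∃ b', edgeMap φ ψ b' = b ∧ (b' = (v, w, f) ∨ b' = (w, v, f)) := by
      rcases hb with rfl | rfl
      · exact ⟨(v, w, f), rfl, Or.inl rfl⟩
      · exact ⟨(w, v, f), rfl, Or.inr rfl⟩
    obtain ⟨a', rfl, ha'⟩ := ha'
    obtain ⟨b', rfl, hb'⟩ := hb'
    exact ⟨({v, w}, {a', b'}), by simp [partMap_apply, Finset.map_insert],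
      Or.inr ⟨v, w, e, f, a', b', hvw', hef', ha', hb', rfl⟩⟩

theorem verts_map (P : Finset (Part α' β')) : verts (P.map (partMap φ ψ)) = (verts P).map φ := by
  ext v
  simp only [verts, Finset.mem_biUnion, Finset.mem_map, partMap_apply]
  constructor
  · rintro ⟨_, ⟨s, hs, rfl⟩, hv⟩
    obtain ⟨u, hu, rfl⟩ := Finset.mem_map.1 hv
    exact ⟨u, ⟨s, hs, hu⟩, rfl⟩
  · rintro ⟨u, ⟨s, hs, hu⟩, rfl⟩
    exact ⟨_, ⟨s, hs, rfl⟩, Finset.mem_map_of_mem φ hu⟩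

theorem edgs_map (P : Finset (Part α' β')) :
    edgs (P.map (partMap φ ψ)) = (edgs P).map (edgeMap φ ψ) := by
  ext v
  simp only [edgs, Finset.mem_biUnion, Finset.mem_map, partMap_apply]
  constructor
  · rintro ⟨_, ⟨s, hs, rfl⟩, hv⟩
    obtain ⟨u, hu, rfl⟩ := Finset.mem_map.1 hv
    exact ⟨u, ⟨s, hs, hu⟩, rfl⟩
  · rintro ⟨u, ⟨s, hs, hu⟩, rfl⟩
    exact ⟨_, ⟨s, hs, rfl⟩, Finset.mem_map_of_mem (edgeMap φ ψ) hu⟩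

theorem labels_map (P : Finset (Part α' β')) :
    labels (P.map (partMap φ ψ)) = (labels P).map ψ := by
  rw [labels, labels, edgs_map, Finset.map_eq_image, Finset.map_eq_image, Finset.image_image,
    Finset.image_image]
  rfl

theorem label_injOn_map (P : Finset (Part α' β')) :
    (∀ a ∈ edgs (P.map (partMap φ ψ)), ∀ b ∈ edgs (P.map (partMap φ ψ)),
      a.2.2 = b.2.2 → a = b) ↔ ∀ a ∈ edgs P, ∀ b ∈ edgs P, a.2.2 = b.2.2 → a = b := by
  rw [edgs_map]
  constructor
  · intro h a ha b hb hab
    exact (edgeMap φ ψ).injective (h _ (Finset.mem_map_of_mem _ ha) _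
      (Finset.mem_map_of_mem _ hb) (by simp [hab]))
  · intro h a ha b hb hab
    obtain ⟨a, ha', rfl⟩ := Finset.mem_map.1 ha
    obtain ⟨b, hb', rfl⟩ := Finset.mem_map.1 hb
    rw [h a ha' b hb' (ψ.injective (by simpa using hab))]

theorem IsPatchwork.map {P : Finset (Part α' β')} (h : IsPatchwork P) :
    IsPatchwork (P.map (partMap φ ψ)) := by
  rw [isPatchwork_iff] at h ⊢
  refine ⟨fun s hs => ?_, (label_injOn_map φ ψ P).2 h.2⟩
  obtain ⟨s, hs', rfl⟩ := Finset.mem_map.1 hs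
  exact (h.1 s hs').imp (Part.IsLoop.partMap φ ψ) (Part.IsDoubleEdge.partMap φ ψ)

variable [Fintype α] [Fintype β] [Fintype α'] [Fintype β']

theorem exists_map_eq {P : Finset (Part α β)} (h : IsPatchwork P)
    (hV : verts P = Finset.univ.map φ) (hL : labels P = Finset.univ.map ψ) :
    ∃ P' : Finset (Part α' β'), IsPatchwork P' ∧ P'.map (partMap φ ψ) = P := by
  have hex : ∀ s ∈ P, ∃ s' : Part α' β', partMap φ ψ s' = s ∧
      (s'.IsLoop ∨ s'.IsDoubleEdge) := by
    intro s hs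
    refine exists_partMap_eq φ ψ ((isPatchwork_iff.1 h).1 s hs) ?_ ?_
    · intro v hv
      have : v ∈ verts P := Finset.mem_biUnion.2 ⟨s, hs, hv⟩
      simpa [hV] using this
    · intro a ha
      have : a.2.2 ∈ labels P :=
        Finset.mem_image_of_mem (fun a => a.2.2) (Finset.mem_biUnion.2 ⟨s, hs, ha⟩)
      simpa [hL] using this
  -- The preimage of `P` is the required patchwork, because every part of `P` is in the image of the
  -- relabelling.
  have hmap : (Finset.univ.filter fun s => partMap φ ψ s ∈ P).map (partMap φ ψ) = P := by
    ext s
    simp only [Finset.mem_map, Finset.mem_filter, Finset.mem_univ, true_and]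
    constructor
    · rintro ⟨s, hs, rfl⟩
      exact hs
    · intro hs
      obtain ⟨s', rfl, -⟩ := hex s hs
      exact ⟨s', hs, rfl⟩
  refine ⟨_, isPatchwork_iff.2 ⟨?_, ?_⟩, hmap⟩
  · intro s hs
    obtain ⟨s', hs', h'⟩ := hex _ (Finset.mem_filter.1 hs).2
    rwa [← (partMap φ ψ).injective hs']
  · rw [← label_injOn_map φ ψ, hmap]
    exact (isPatchwork_iff.1 h).2

open Classical in
theorem sum_patchwork_relabel :
    (∑ P : Finset (Part α β) with IsPatchwork P ∧ verts P = Finset.univ.map φ ∧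
      labels P = Finset.univ.map ψ, (-1 : ℚ) ^ P.card) =
    ∑ P : Finset (Part α' β') with IsPatchwork P ∧ verts P = Finset.univ ∧
      labels P = Finset.univ, (-1 : ℚ) ^ P.card := by
  symm
  refine Finset.sum_nbij (fun P => P.map (partMap φ ψ)) ?_ ?_ ?_ ?_
  · intro P hP
    obtain ⟨-, h, hV, hL⟩ := Finset.mem_filter.1 hP
    refine Finset.mem_filter.2 ⟨Finset.mem_univ _, h.map φ ψ, ?_, ?_⟩
    · rw [verts_map, hV]
    · rw [labels_map, hL]
  · exact (Finset.map_injective _).injOn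
  · intro P hP
    obtain ⟨-, h, hV, hL⟩ := Finset.mem_filter.1 hP
    obtain ⟨P', h', rfl⟩ := exists_map_eq φ ψ h hV hL
    rw [verts_map, Finset.map_inj] at hV
    rw [labels_map, Finset.map_inj] at hL
    exact ⟨P', Finset.mem_coe.2 (Finset.mem_filter.2 ⟨Finset.mem_univ _, h', hV, hL⟩), rfl⟩
  · intro P _
    simp

end Patchworks

open Classical in
/-- The signed number of patchworks with `n` vertices and `m` edges. -/
def patchworkSum (n m : ℕ) : ℚ :=
  ∑ P : Finset (Part (Fin n) (Fin m)) with P ∈ patchworks n m, (-1 : ℚ) ^ P.card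

open Classical in
theorem coeff_patchworkGFAt (n m : ℕ) :
    MvPowerSeries.coeff (expo n m) (patchworkGFAt (-1)) =
      patchworkSum n m / (2 ^ m * m.factorial * n.factorial) := by
  have : MvPowerSeries.coeff (expo n m) patchworkGF =
      ∑ P : Finset (Part (Fin n) (Fin m)) with P ∈ patchworks n m,
        Polynomial.C (1 / ((2 : ℚ) ^ m * m.factorial * n.factorial)) *
          Polynomial.X ^ P.card := rfl
  rw [patchworkGFAt, MvPowerSeries.coeff_map, this, map_sum, patchworkSum, Finset.sum_div]
  refine Finset.sum_congr rfl fun P _ => ?_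
  simp [div_eq_inv_mul]

theorem univ_map_equivFin {γ : Type*} (B : Finset γ) :
    Finset.univ.map (B.equivFin.symm.toEmbedding.trans (Function.Embedding.subtype _)) = B := by
  rw [← Finset.map_map, Finset.map_univ_equiv, Finset.univ_eq_attach, Finset.attach_map_val]

-- Relabelling along enumerations of `A` and `K` reduces to the labels `Fin A.card` and `Fin
-- K.card`.
open Classical in
theorem sum_patchwork_eq_patchworkSum {α β : Type*} [Fintype α] [Fintype β]
    [DecidableEq α] [DecidableEq β] (A : Finset α) (K : Finset β) :
    (∑ P : Finset (Part α β) with IsPatchwork P ∧ verts P = A ∧ labels P = K,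
      (-1 : ℚ) ^ P.card) = patchworkSum A.card K.card := by
  have h := sum_patchwork_relabel
    (A.equivFin.symm.toEmbedding.trans (Function.Embedding.subtype _))
    (K.equivFin.symm.toEmbedding.trans (Function.Embedding.subtype _))
  rw [univ_map_equivFin, univ_map_equivFin] at h
  refine h.trans ?_
  rw [patchworkSum]
  congr 1
  ext P
  simp only [Finset.mem_filter]
  exact Iff.rfl

/-! ### Half-edge maps: multigraphs with all the edge labels of `β` -/

section HalfEdges

variable {α β : Type*} [DecidableEq α] [DecidableEq β] [Fintype α] [Fintype β]

/-- The edge with label `e` of a half-edge map. -/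
def edgeOf (f : β × Bool → α) (e : β) : α × α × β := (f (e, false), f (e, true), e)

/-- The multigraph with vertices `α` whose edge labelled `e` goes from `f (e, false)` to
`f (e, true)`. -/
def toMultigraph (f : β × Bool → α) : Multigraph α β where
  vertices := Finset.univ
  edges := Finset.univ.image (edgeOf f)
  left_mem _ _ := Finset.mem_univ _
  right_mem _ _ := Finset.mem_univ _
  label_injOn := by
    intro a ha b hb hab
    obtain ⟨e, -, rfl⟩ := Finset.mem_image.1 ha
    obtain ⟨e', -, rfl⟩ := Finset.mem_image.1 hb
    have : e = e' := hab
    rw [this]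

theorem mem_edges_toMultigraph {f : β × Bool → α} {a : α × α × β} :
    a ∈ (toMultigraph f).edges ↔ f (a.2.2, false) = a.1 ∧ f (a.2.2, true) = a.2.1 := by
  obtain ⟨v, w, e⟩ := a
  simp [toMultigraph, edgeOf]

/-- Every vertex has degree at least two, where loops count twice. -/
def MinDegTwo (f : β × Bool → α) : Prop := ∀ v, 2 ≤ Finset.card {x | f x = v}

theorem mem_LD_toMultigraph {f : β × Bool → α} {s : Part α β} :
    s ∈ (toMultigraph f).LD ↔
      s.2 ⊆ (toMultigraph f).edges ∧ (s.IsLoop ∨ s.IsDoubleEdge) :=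
  ⟨fun h => h.2, fun h => ⟨Finset.subset_univ _, h⟩⟩

theorem isPatchwork_of_subset_LD {f : β × Bool → α} {P : Finset (Part α β)}
    (h : ∀ s ∈ P, s ∈ (toMultigraph f).LD) : IsPatchwork P := by
  have hE : edgs P ⊆ (toMultigraph f).edges :=
    Finset.biUnion_subset.2 fun s hs => (h s hs).2.1
  exact isPatchwork_iff.2 ⟨fun s hs => (h s hs).2.2, fun a ha b hb =>
    (toMultigraph f).label_injOn a (hE ha) b (hE hb)⟩

theorem IsPatchwork.subset_LD_iff {f : β × Bool → α} {P : Finset (Part α β)}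
    (h : IsPatchwork P) :
    (∀ s ∈ P, s ∈ (toMultigraph f).LD) ↔ edgs P ⊆ (toMultigraph f).edges := by
  refine ⟨fun hP => Finset.biUnion_subset.2 fun s hs => (hP s hs).2.1, fun hE s hs => ?_⟩
  exact mem_LD_toMultigraph.2 ⟨(Finset.subset_biUnion_of_mem Prod.snd hs).trans hE,
    (isPatchwork_iff.1 h).1 s hs⟩

/-- A loop has both of its half-edges at its vertex; each edge of a double edge has one half-edge at
either end. -/
theorem two_le_card_fiber_of_mem_LD {f : β × Bool → α} {s : Part α β}
    (hs : s ∈ (toMultigraph f).LD) {v : α} (hv : v ∈ s.1) :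
    2 ≤ Finset.card {x | f x = v} := by
  obtain ⟨hE, hs⟩ := mem_LD_toMultigraph.1 hs
  rcases hs with ⟨u, e, rfl⟩ | ⟨u, w, e, e', a, b, huw, hee, ha, hb, rfl⟩
  · obtain rfl := Finset.mem_singleton.1 hv
    have := mem_edges_toMultigraph.1 (hE (Finset.mem_singleton_self _))
    exact Finset.one_lt_card.2 ⟨(e, false), by simpa using this.1, (e, true),
      by simpa using this.2, by simp⟩
  · have h1 := mem_edges_toMultigraph.1 (hE (Finset.mem_insert_self _ _))
    have h2 := mem_edges_toMultigraph.1
      (hE (Finset.mem_insert_of_mem (Finset.mem_singleton_self _)))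
    have h1' : ∃ c, f (e, c) = v := by
      simp only [Finset.mem_insert, Finset.mem_singleton] at hv
      rcases ha with rfl | rfl <;> rcases hv with rfl | rfl
      exacts [⟨_, h1.1⟩, ⟨_, h1.2⟩, ⟨_, h1.2⟩, ⟨_, h1.1⟩]
    have h2' : ∃ c, f (e', c) = v := by
      simp only [Finset.mem_insert, Finset.mem_singleton] at hv
      rcases hb with rfl | rfl <;> rcases hv with rfl | rfl
      exacts [⟨_, h2.1⟩, ⟨_, h2.2⟩, ⟨_, h2.2⟩, ⟨_, h2.1⟩]
    obtain ⟨c, hc⟩ := h1'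
    obtain ⟨c', hc'⟩ := h2'
    exact Finset.one_lt_card.2 ⟨(e, c), by simpa using hc, (e', c'), by simpa using hc',
      by simp [hee]⟩

/-- The half-edges with labels off `K`. -/
def restrictOff (K : Finset β) (f : β × Bool → α) : {e // e ∉ K} × Bool → α :=
  fun x => f (x.1, x.2)

/-- A half-edge whose label occurs in `P` is attached to a vertex of `P`, so discarding it does not
affect the degrees elsewhere. -/
theorem card_fiber_restrictOff {f : β × Bool → α} {P : Finset (Part α β)}
    (hP : ∀ s ∈ P, s ∈ (toMultigraph f).LD) {v : α} (hv : v ∉ verts P) :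
    Finset.card {x | restrictOff (labels P) f x = v} = Finset.card {x | f x = v} := by
  refine Finset.card_nbij (fun x => (x.1.1, x.2)) ?_ ?_ ?_
  · intro x hx
    exact Finset.mem_filter.2 ⟨Finset.mem_univ _, (Finset.mem_filter.1 hx).2⟩
  · rintro ⟨⟨e, _⟩, b⟩ _ ⟨⟨e', _⟩, b'⟩ _ h
    simpa using h
  · rintro ⟨e, b⟩ hx
    have hx : f (e, b) = v := by simpa using hx
    have he : e ∉ labels P := by
      intro he
      obtain ⟨a, ha, rfl⟩ := Finset.mem_image.1 he
      obtain ⟨s, hs, has⟩ := Finset.mem_biUnion.1 ha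
      have hmem := mem_edges_toMultigraph.1 ((hP s hs).2.1 has)
      have hends := ends_mem (hP s hs).2.2 has
      refine hv (Finset.mem_biUnion.2 ⟨s, hs, ?_⟩)
      cases b
      · rw [← hx, hmem.1]
        exact hends.1
      · rw [← hx, hmem.2]
        exact hends.2
    exact ⟨(⟨e, he⟩, b), Finset.mem_coe.2 (Finset.mem_filter.2 ⟨Finset.mem_univ _, hx⟩), rfl⟩

open Classical in
/-- Completing a patchwork to a multigraph of minimal degree at least two. -/
theorem card_completions {P : Finset (Part α β)} (h : IsPatchwork P) :
    Finset.card {f : β × Bool → α | MinDegTwo f ∧ ∀ s ∈ P, s ∈ (toMultigraph f).LD} =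
      Finset.card {g : {e // e ∉ labels P} × Bool → α |
        ∀ v ∉ verts P, 2 ≤ Finset.card {x | g x = v}} := by
  have hex : ∀ e ∈ labels P, ∃ a ∈ edgs P, a.2.2 = e := fun e he => Finset.mem_image.1 he
  choose a ha hae using hex
  -- The inverse fills in each label of `P` with the ends of the edge `a e` of `P` that carries it;
  -- this edge is unique since `P` is a patchwork.
  refine Finset.card_nbij' (restrictOff (labels P))
    (fun g x => if hx : x.1 ∈ labels P then
      (if x.2 then (a x.1 hx).2.1 else (a x.1 hx).1) else g (⟨x.1, hx⟩, x.2)) ?_ ?_ ?_ ?_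
  · intro f hf
    obtain ⟨hdeg, hP⟩ := (Finset.mem_filter.1 hf).2
    refine Finset.mem_filter.2 ⟨Finset.mem_univ _, fun v hv => ?_⟩
    rw [card_fiber_restrictOff hP hv]
    exact hdeg v
  · intro g hg
    have hg := (Finset.mem_filter.1 hg).2
    refine Finset.mem_filter.2 ⟨Finset.mem_univ _, ?_⟩
    set f : β × Bool → α := fun x => if hx : x.1 ∈ labels P then
      (if x.2 then (a x.1 hx).2.1 else (a x.1 hx).1) else g (⟨x.1, hx⟩, x.2) with hf
    have hP : ∀ s ∈ P, s ∈ (toMultigraph f).LD := by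
      rw [h.subset_LD_iff]
      intro b hb
      have hbl : b.2.2 ∈ labels P := Finset.mem_image_of_mem _ hb
      have : a b.2.2 hbl = b :=
        (isPatchwork_iff.1 h).2 _ (ha _ hbl) _ hb (hae _ hbl)
      rw [mem_edges_toMultigraph]
      simp [hf, hbl, this]
    refine ⟨fun v => ?_, hP⟩
    by_cases hv : v ∈ verts P
    · obtain ⟨s, hs, hvs⟩ := Finset.mem_biUnion.1 hv
      exact two_le_card_fiber_of_mem_LD (hP s hs) hvs
    · rw [← card_fiber_restrictOff hP hv]
      have : restrictOff (labels P) f = g := by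
        ext ⟨⟨e, he⟩, b⟩
        simp [restrictOff, hf, he]
      rw [this]
      exact hg v hv
  · intro f hf
    obtain ⟨-, hP⟩ := (Finset.mem_filter.1 hf).2
    ext ⟨e, b⟩
    by_cases he : e ∈ labels P
    · have hmem := mem_edges_toMultigraph.1 (h.subset_LD_iff.1 hP (ha e he))
      rw [hae] at hmem
      cases b <;> simp [he, hmem]
    · simp [he, restrictOff]
  · intro g _
    ext ⟨⟨e, he⟩, b⟩
    simp [restrictOff, he]

/-- The number of half-edge maps on `2 m` half-edges and `i` vertices in which all but `a` given
vertices have degree at least two. -/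
def halfEdgeCount (m a b : ℕ) : ℚ :=
  (2 * m).factorial * PowerSeries.coeff (2 * m)
    (PowerSeries.exp ℚ ^ a * (PowerSeries.exp ℚ - 1 - PowerSeries.X) ^ b)

open Classical in
theorem card_completions_eq_halfEdgeCount {P : Finset (Part α β)} (h : IsPatchwork P) :
    (Finset.card {f : β × Bool → α | MinDegTwo f ∧ ∀ s ∈ P, s ∈ (toMultigraph f).LD} : ℚ) =
      halfEdgeCount (Fintype.card β - (labels P).card) (verts P).card
        (Fintype.card α - (verts P).card) := by
  have hcard : Fintype.card ({e // e ∉ labels P} × Bool) =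
      2 * (Fintype.card β - (labels P).card) := by
    rw [Fintype.card_prod, Fintype.card_bool, mul_comm, Fintype.card_subtype_compl,
      Fintype.card_coe]
  rw [card_completions h, halfEdgeCount, ← hcard, ← card_two_le_fiber]

open Classical in
/-- Inclusion-exclusion over the loops and double edges. -/
theorem card_simple_minDegTwo :
    (Finset.card {f : β × Bool → α | MinDegTwo f ∧ (toMultigraph f).LD = ∅} : ℚ) =
      ∑ A : Finset α, ∑ K : Finset β, patchworkSum A.card K.card *
        halfEdgeCount (Fintype.card β - K.card) A.card (Fintype.card α - A.card) := by
  -- The alternating sum over the subsets of `LD` is `1` if `LD` is empty and `0` otherwise.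
  have hie : ∀ f : β × Bool → α, (if (toMultigraph f).LD = ∅ then (1 : ℚ) else 0) =
      ∑ P : Finset (Part α β), if ∀ s ∈ P, s ∈ (toMultigraph f).LD then (-1 : ℚ) ^ P.card
        else 0 := by
    intro f
    have h := Finset.sum_powerset_neg_one_pow_card
      (x := Finset.univ.filter fun s : Part α β => s ∈ (toMultigraph f).LD)
    have h' := congrArg (Int.cast : ℤ → ℚ) h
    push_cast at h'
    rw [← Finset.sum_filter]
    have hpow : (Finset.univ.filter fun s : Part α β => s ∈ (toMultigraph f).LD).powerset =
        Finset.univ.filter fun P => ∀ s ∈ P, s ∈ (toMultigraph f).LD := by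
      ext P
      simp [Finset.subset_iff]
    rw [← hpow, h']
    refine if_congr ?_ rfl rfl
    rw [Finset.filter_eq_empty_iff, Set.eq_empty_iff_forall_notMem]
    simp
  calc (Finset.card {f : β × Bool → α | MinDegTwo f ∧ (toMultigraph f).LD = ∅} : ℚ)
      = ∑ f : β × Bool → α with MinDegTwo f, if (toMultigraph f).LD = ∅ then (1 : ℚ) else 0 := by
        rw [← Finset.filter_filter, Finset.card_filter, Nat.cast_sum]
        simp
    _ = ∑ P : Finset (Part α β), (-1 : ℚ) ^ P.card *
          Finset.card {f : β × Bool → α | MinDegTwo f ∧ ∀ s ∈ P, s ∈ (toMultigraph f).LD} := by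
        simp_rw [hie]
        rw [Finset.sum_comm]
        refine Finset.sum_congr rfl fun P _ => ?_
        rw [← Finset.filter_filter, Finset.card_filter _ (Finset.filter _ _), Nat.cast_sum,
          Finset.mul_sum]
        refine Finset.sum_congr rfl fun f _ => ?_
        by_cases hf : ∀ s ∈ P, s ∈ (toMultigraph f).LD
        · rw [if_pos hf, if_pos hf, Nat.cast_one, mul_one]
        · rw [if_neg hf, if_neg hf, Nat.cast_zero, mul_zero]
    _ = ∑ P : Finset (Part α β) with IsPatchwork P, (-1 : ℚ) ^ P.card *
          Finset.card {f : β × Bool → α | MinDegTwo f ∧ ∀ s ∈ P, s ∈ (toMultigraph f).LD} := by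
        -- A set `P` that is not a patchwork lies in no `LD`, so its term is zero.
        rw [Finset.sum_filter]
        refine Finset.sum_congr rfl fun P _ => ?_
        split_ifs with h
        · rfl
        · rw [Finset.filter_eq_empty_iff.2, Finset.card_empty, Nat.cast_zero, mul_zero]
          exact fun f _ hf => h (isPatchwork_of_subset_LD hf.2)
    _ = ∑ P : Finset (Part α β) with IsPatchwork P, (-1 : ℚ) ^ P.card *
          halfEdgeCount (Fintype.card β - (labels P).card) (verts P).card
            (Fintype.card α - (verts P).card) := by
        refine Finset.sum_congr rfl fun P hP => ?_
        rw [card_completions_eq_halfEdgeCount (Finset.mem_filter.1 hP).2]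
    _ = ∑ AK : Finset α × Finset β, ∑ P : Finset (Part α β) with IsPatchwork P ∧
          (verts P, labels P) = AK, (-1 : ℚ) ^ P.card *
          halfEdgeCount (Fintype.card β - (labels P).card) (verts P).card
            (Fintype.card α - (verts P).card) := by
        rw [← Finset.sum_fiberwise _ fun P => (verts P, labels P)]
        simp only [Finset.filter_filter]
    _ = _ := by
        rw [Fintype.sum_prod_type]
        refine Finset.sum_congr rfl fun A _ => Finset.sum_congr rfl fun K _ => ?_
        rw [← sum_patchwork_eq_patchworkSum, Finset.sum_mul]
        simp only [Prod.mk.injEq]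
        refine Finset.sum_congr rfl fun P hP => ?_
        obtain ⟨-, -, rfl, rfl⟩ := Finset.mem_filter.1 hP
        rfl

end HalfEdges

/-! ### Multigraphs without loops and double edges, and simple graphs -/

section SimpleGraphs

variable {α β : Type*}

/-- The unordered pair of ends of the edge labelled `e`. -/
def ends (f : β × Bool → α) (e : β) : Sym2 α := s(f (e, false), f (e, true))

theorem ends_eq_iff {f : β × Bool → α} {e : β} {v w : α} :
    ends f e = s(v, w) ↔ ∃ c, f (e, c) = v ∧ f (e, !c) = w := by
  simp only [ends, Sym2.eq_iff, Bool.exists_bool, Bool.not_false, Bool.not_true]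
  tauto

theorem ends_apply (f : β × Bool → α) (e : β) (c : Bool) :
    ends f e = s(f (e, c), f (e, !c)) :=
  ends_eq_iff.2 ⟨c, rfl, rfl⟩

/-- Sending a half-edge at `v` to the end of its opposite half-edge is a bijection onto the
neighbours of `v`: injectivity of `ends` excludes repeated edges. -/
theorem ncard_neighborSet_eq_card_fiber [DecidableEq α] [Fintype β] {f : β × Bool → α}
    {G : SimpleGraph α} (hinj : Function.Injective (ends f)) (hG : Set.range (ends f) = G.edgeSet)
    (v : α) : (G.neighborSet v).ncard = Finset.card {x | f x = v} := by
  have himage : G.neighborSet v =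
      (fun x : β × Bool => f (x.1, !x.2)) ''
        ((Finset.univ.filter fun x => f x = v : Finset (β × Bool)) : Set (β × Bool)) := by
    ext w
    rw [SimpleGraph.mem_neighborSet, ← SimpleGraph.mem_edgeSet, ← hG]
    simp [ends_eq_iff, -Bool.exists_bool]
  rw [himage, Set.InjOn.ncard_image, Set.ncard_coe_finset]
  rintro ⟨e, c⟩ hx ⟨e', c'⟩ hx' h
  have hx : f (e, c) = v := by simpa using hx
  have hx' : f (e', c') = v := by simpa using hx'
  have h : f (e, !c) = f (e', !c') := h
  obtain rfl : e = e' := by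
    apply hinj
    rw [ends_apply f e c, ends_apply f e' c', hx, hx', h]
  have hadj : G.Adj v (f (e, !c)) := by
    rw [← SimpleGraph.mem_edgeSet, ← hG, ← hx, ← ends_apply]
    exact Set.mem_range_self e
  -- If both half-edges of `e` were at `v`, then `e` would be a loop of the simple graph `G`.
  rcases eq_or_ne c c' with rfl | hc
  · rfl
  · have : c' = !c := by cases c <;> cases c' <;> simp_all
    subst this
    exact absurd hx'.symm hadj.ne

variable [Fintype α] [Fintype β] [DecidableEq α] [DecidableEq β]

theorem LD_eq_empty_iff {f : β × Bool → α} :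
    (toMultigraph f).LD = ∅ ↔ (∀ e, ¬ (ends f e).IsDiag) ∧ Function.Injective (ends f) := by
  constructor
  · intro h
    have hloop : ∀ e, ¬ (ends f e).IsDiag := by
      intro e he
      have he : f (e, false) = f (e, true) := by simpa [ends] using he
      have hmem : (({f (e, true)}, {(f (e, true), f (e, true), e)}) : Part α β) ∈
          (toMultigraph f).LD := by
        refine mem_LD_toMultigraph.2 ⟨?_, Or.inl ⟨_, _, rfl⟩⟩
        rw [Finset.singleton_subset_iff, mem_edges_toMultigraph]
        exact ⟨he, rfl⟩
      rw [h] at hmem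
      exact hmem
    refine ⟨hloop, fun e e' hee => ?_⟩
    by_contra hne
    have hmem : (({f (e, false), f (e, true)}, {edgeOf f e, edgeOf f e'}) : Part α β) ∈
        (toMultigraph f).LD := by
      refine mem_LD_toMultigraph.2 ⟨?_, Or.inr ⟨f (e, false), f (e, true), e, e', edgeOf f e,
        edgeOf f e', ?_, hne, Or.inl rfl, ?_, rfl⟩⟩
      · intro a ha
        simp only [Finset.mem_insert, Finset.mem_singleton] at ha
        rcases ha with rfl | rfl <;> exact Finset.mem_image_of_mem _ (Finset.mem_univ _)
      · simpa [ends] using hloop e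
      · rcases Sym2.eq_iff.1 hee with ⟨h1, h2⟩ | ⟨h1, h2⟩
        · left
          simp [edgeOf, h1, h2]
        · right
          simp [edgeOf, h1, h2]
    rw [h] at hmem
    exact hmem
  · rintro ⟨hloop, hinj⟩
    refine Set.eq_empty_of_forall_notMem fun s hs => ?_
    obtain ⟨hE, hs⟩ := mem_LD_toMultigraph.1 hs
    rcases hs with ⟨u, e, rfl⟩ | ⟨u, w, e, e', a, b, huw, hee, ha, hb, rfl⟩
    · have := mem_edges_toMultigraph.1 (hE (Finset.mem_singleton_self _))
      apply hloop e
      simp only at this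
      simp [ends, this]
    · have h1 := mem_edges_toMultigraph.1 (hE (Finset.mem_insert_self _ _))
      have h2 := mem_edges_toMultigraph.1
        (hE (Finset.mem_insert_of_mem (Finset.mem_singleton_self _)))
      have h1' : ends f e = s(u, w) := by
        rcases ha with rfl | rfl
        exacts [ends_eq_iff.2 ⟨false, h1⟩, ends_eq_iff.2 ⟨true, h1.symm⟩]
      have h2' : ends f e' = s(u, w) := by
        rcases hb with rfl | rfl
        exacts [ends_eq_iff.2 ⟨false, h2⟩, ends_eq_iff.2 ⟨true, h2.symm⟩]
      exact hee (hinj (h1'.trans h2'.symm))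

theorem card_mk_eq {z : Sym2 α} (hz : ¬ z.IsDiag) :
    Finset.card {p : α × α | s(p.1, p.2) = z} = 2 := by
  induction z using Sym2.ind with
  | _ x y =>
    have hxy : x ≠ y := by simpa using hz
    have : (Finset.univ.filter fun p : α × α => s(p.1, p.2) = s(x, y)) = {(x, y), (y, x)} := by
      ext ⟨a, b⟩
      simp
    rw [this, Finset.card_pair]
    simp [hxy]

/-- Each edge independently chooses one of the two orderings of its two distinct ends. -/
theorem card_orientations (r : β → Sym2 α) (hr : ∀ e, ¬ (r e).IsDiag) :
    Finset.card {f : β × Bool → α | ends f = r} = 2 ^ Fintype.card β := by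
  have h : Finset.card {f : β × Bool → α | ends f = r} =
      (Fintype.piFinset fun e => Finset.univ.filter fun p : α × α => s(p.1, p.2) = r e).card := by
    refine Finset.card_equiv ((Equiv.curry β Bool α).trans
      (Equiv.piCongrRight fun _ => Equiv.boolArrowEquivProd α)) fun f => ?_
    simp [funext_iff, ends]
  rw [h, Fintype.card_piFinset, Finset.prod_congr rfl fun e _ => card_mk_eq (hr e)]
  simp

open Classical in
theorem card_labellings (S : Set (Sym2 α)) (hS : S.ncard = Fintype.card β) :
    Finset.card {r : β → Sym2 α | Function.Injective r ∧ Set.range r = S} =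
      (Fintype.card β).factorial := by
  have hcard : Fintype.card β = Fintype.card S := by
    rw [← hS, Set.ncard_eq_toFinset_card', Set.toFinset_card]
  rw [← Fintype.card_equiv (Fintype.equivOfCardEq hcard), ← Finset.card_univ]
  symm
  refine Finset.card_bij (fun σ _ e => (σ e : Sym2 α)) ?_ ?_ ?_
  · intro σ _
    refine Finset.mem_filter.2 ⟨Finset.mem_univ _,
      Subtype.val_injective.comp σ.injective, ?_⟩
    rw [← Function.comp_def, Set.range_comp, σ.surjective.range_eq]
    simp
  · intro σ _ τ _ h
    ext e
    rw [congrFun h e]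
  · intro r hr
    obtain ⟨-, hinj, hrS⟩ := Finset.mem_filter.1 hr
    exact ⟨(Equiv.ofInjective r hinj).trans (Equiv.setCongr hrS), Finset.mem_univ _, rfl⟩

-- Fibring over `ends` separates the labellings of the edge set from the orientations of the
-- labelled edges.
open Classical in
theorem card_labelled_orientations (G : SimpleGraph α) (hG : G.edgeSet.ncard = Fintype.card β) :
    Finset.card {f : β × Bool → α | Function.Injective (ends f) ∧
      Set.range (ends f) = G.edgeSet} = 2 ^ Fintype.card β * (Fintype.card β).factorial := by
  rw [Finset.card_eq_sum_card_fiberwise (f := ends)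
    (t := Finset.univ.filter fun r : β → Sym2 α => Function.Injective r ∧
      Set.range r = G.edgeSet) fun f hf => by simpa using hf]
  rw [Finset.sum_congr rfl (g := fun _ => 2 ^ Fintype.card β), Finset.sum_const,
    card_labellings _ hG, smul_eq_mul, mul_comm]
  intro r hr
  obtain ⟨-, hinj, hrange⟩ := Finset.mem_filter.1 hr
  rw [← card_orientations r fun e =>
    G.not_isDiag_of_mem_edgeSet (hrange ▸ Set.mem_range_self e), Finset.filter_filter]
  congr 1
  ext f
  simp only [Finset.mem_filter, Finset.mem_univ, true_and]
  constructor
  · exact fun h => h.2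
  · rintro rfl
    exact ⟨⟨hinj, hrange⟩, rfl⟩

end SimpleGraphs

open Classical in
/-- A core with `j` edges has `2^j j!` labellings and orientations of its edges. -/
theorem card_simple_minDegTwo_eq (i j : ℕ) :
    Finset.card {f : Fin j × Bool → Fin i | MinDegTwo f ∧ (toMultigraph f).LD = ∅} =
      2 ^ j * j.factorial *
        Set.ncard {G : SimpleGraph (Fin i) | G ∈ cores i ∧ G.edgeSet.ncard = j} := by
  -- `SimpleGraph.fromEdgeSet` discards diagonal pairs; without loops there are none.
  have hedge : ∀ f : Fin j × Bool → Fin i, (toMultigraph f).LD = ∅ →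
      (SimpleGraph.fromEdgeSet (Set.range (ends f))).edgeSet = Set.range (ends f) := by
    intro f hf
    rw [SimpleGraph.edgeSet_fromEdgeSet, sdiff_eq_left, Set.disjoint_left]
    rintro _ ⟨e, rfl⟩
    exact (LD_eq_empty_iff.1 hf).1 e
  have hmaps : ∀ f ∈ Finset.univ.filter fun f : Fin j × Bool → Fin i =>
      MinDegTwo f ∧ (toMultigraph f).LD = ∅, SimpleGraph.fromEdgeSet (Set.range (ends f)) ∈
        Finset.univ.filter fun G => G ∈ cores i ∧ G.edgeSet.ncard = j := by
    intro f hf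
    obtain ⟨-, hdeg, hLD⟩ := Finset.mem_filter.1 hf
    have hinj := (LD_eq_empty_iff.1 hLD).2
    refine Finset.mem_filter.2 ⟨Finset.mem_univ _, fun v => ?_, ?_⟩
    · rw [ncard_neighborSet_eq_card_fiber hinj (hedge f hLD).symm]
      exact hdeg v
    · rw [hedge f hLD, ← Set.image_univ, Set.ncard_image_of_injective _ hinj, Set.ncard_univ]
      simp
  -- Every core with `j` edges has a fibre of the same size `2 ^ j * j!`, namely its labelled
  -- orientations.
  rw [Finset.card_eq_sum_card_fiberwise hmaps,
    Finset.sum_congr rfl (g := fun _ => 2 ^ j * j.factorial), Finset.sum_const, smul_eq_mul,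
    mul_comm, ← Set.ncard_coe_finset]
  · simp
  intro G hG
  obtain ⟨-, hcore, hcard⟩ := Finset.mem_filter.1 hG
  have h := card_labelled_orientations (β := Fin j) G (by simpa using hcard)
  rw [Fintype.card_fin] at h
  rw [← h, Finset.filter_filter]
  congr 1
  ext f
  simp only [Finset.mem_filter, Finset.mem_univ, true_and]
  constructor
  · rintro ⟨⟨-, hLD⟩, rfl⟩
    exact ⟨(LD_eq_empty_iff.1 hLD).2, (hedge f hLD).symm⟩
  · rintro ⟨hinj, hrange⟩
    refine ⟨⟨fun v => ?_, LD_eq_empty_iff.2 ⟨fun e => ?_, hinj⟩⟩, ?_⟩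
    · rw [← ncard_neighborSet_eq_card_fiber hinj hrange]
      exact hcore v
    · exact G.not_isDiag_of_mem_edgeSet (hrange ▸ Set.mem_range_self e)
    · rw [hrange, SimpleGraph.fromEdgeSet_edgeSet]

/-! ### The generating function of cores -/

/-- The number of cores, as a signed sum over patchworks. -/
theorem ncard_cores (i j : ℕ) :
    (2 ^ j * j.factorial *
      Set.ncard {G : SimpleGraph (Fin i) | G ∈ cores i ∧ G.edgeSet.ncard = j} : ℚ) =
      ∑ a ∈ Finset.range (i + 1), ∑ k ∈ Finset.range (j + 1),
        (i.choose a : ℚ) * (j.choose k : ℚ) *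
          (patchworkSum a k * halfEdgeCount (j - k) a (i - a)) := by
  classical
  have h := card_simple_minDegTwo (α := Fin i) (β := Fin j)
  rw [card_simple_minDegTwo_eq] at h
  push_cast at h
  rw [h]
  simp only [Fintype.card_fin]
  have hK : ∀ a : ℕ, ∑ K : Finset (Fin j), patchworkSum a K.card *
      halfEdgeCount (j - K.card) a (i - a) = ∑ k ∈ Finset.range (j + 1), (j.choose k : ℚ) *
        (patchworkSum a k * halfEdgeCount (j - k) a (i - a)) := by
    intro a
    -- The summand depends on `K` only through its size, whence the binomial coefficient; the same
    -- is done below for the vertex sets `A`.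
    have := Finset.sum_powerset_apply_card
      (fun k => patchworkSum a k * halfEdgeCount (j - k) a (i - a))
      (x := (Finset.univ : Finset (Fin j)))
    simpa using this
  simp only [hK]
  have := Finset.sum_powerset_apply_card
    (fun a => ∑ k ∈ Finset.range (j + 1), (j.choose k : ℚ) *
      (patchworkSum a k * halfEdgeCount (j - k) a (i - a)))
    (x := (Finset.univ : Finset (Fin i)))
  simpa [Finset.mul_sum, mul_assoc] using this

theorem coeff_coeffX (k : ℕ) (F : MvPowerSeries (Fin 3) ℚ) (d : Fin 2 →₀ ℕ) :
    MvPowerSeries.coeff d (coeffX k F) = MvPowerSeries.coeff (Finsupp.cons k d) F := rfl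

theorem coeff_summand (m i j : ℕ) :
    MvPowerSeries.coeff (expo i j) (((2 * m).factorial : ℚ) • coeffX (2 * m) coreIntegrand *
      (((2 : ℚ) ^ m * m.factorial)⁻¹ • (MvPowerSeries.X 1 : MvPowerSeries (Fin 2) ℚ) ^ m)) =
      if m ≤ j then (2 * m).factorial / (2 ^ m * m.factorial) *
        PowerSeries.coeff (2 * m) (slice coreIntegrand (expo i (j - m))) else 0 := by
  have hle : Finsupp.single (1 : Fin 2) m ≤ expo i j ↔ m ≤ j := by
    rw [Finsupp.single_le_iff, expo_one]
  have hsub : expo i j - Finsupp.single 1 m = expo i (j - m) := by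
    ext k
    fin_cases k <;> simp
  rw [mul_smul_comm, smul_mul_assoc, MvPowerSeries.coeff_smul, MvPowerSeries.coeff_smul,
    MvPowerSeries.X_pow_eq, MvPowerSeries.coeff_mul_monomial, hsub]
  simp only [hle]
  split_ifs with h
  · rw [coeff_slice, coeff_coeffX]
    ring
  · simp

theorem sum_coeff_summand (i j : ℕ) :
    ∑ m ∈ Finset.range (j + 1), ((2 * m).factorial / (2 ^ m * m.factorial) : ℚ) *
      PowerSeries.coeff (2 * m) (slice coreIntegrand (expo i (j - m))) =
      Set.ncard {G : SimpleGraph (Fin i) | G ∈ cores i ∧ G.edgeSet.ncard = j} /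
        i.factorial := by
  have h2 : (2 ^ j * j.factorial : ℚ) ≠ 0 := by positivity
  have hi : (i.factorial : ℚ) ≠ 0 := by positivity
  rw [eq_div_iff hi, ← mul_right_inj' h2, ncard_cores, Finset.sum_mul, Finset.mul_sum]
  -- Reflection replaces the number `k` of labels used by the patchwork by the number `m = j - k` of
  -- remaining edges.
  conv_rhs => rw [Finset.sum_comm, ← Finset.sum_range_reflect]
  refine Finset.sum_congr rfl fun m hm => ?_
  have hmj : m ≤ j := Nat.lt_succ_iff.1 (Finset.mem_range.1 hm)
  rw [slice_coreIntegrand, map_sum, Finset.mul_sum, Finset.sum_mul, Finset.mul_sum,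
    Finset.Nat.sum_antidiagonal_eq_sum_range_succ_mk]
  refine Finset.sum_congr rfl fun a ha => ?_
  have hai : a ≤ i := Nat.lt_succ_iff.1 (Finset.mem_range.1 ha)
  have hpow : (2 : ℚ) ^ j = 2 ^ (j - m) * 2 ^ m := by rw [← pow_add, Nat.sub_add_cancel hmj]
  -- With the binomials written as factorials, `i! / (a! (i-a)!)` and `j! / ((j-m)! m!)` supply the
  -- denominators of the patchwork series, of the exponential and of `w^m / (2^m m!)`.
  rw [Nat.add_sub_cancel, Nat.sub_sub_self hmj, Nat.cast_choose ℚ hai,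
    Nat.cast_choose ℚ (Nat.sub_le j m), Nat.sub_sub_self hmj, coeff_patchworkGFAt, halfEdgeCount,
    PowerSeries.coeff_smul, smul_eq_mul, hpow]
  field_simp

end CoreEnum

end

theorem mainTheorem3 :
    CoreEnum.HasFormalSum
      (fun m : ℕ =>
        ((2 * m).factorial : ℚ) • CoreEnum.coeffX (2 * m) CoreEnum.coreIntegrand *
          (((2 : ℚ) ^ m * m.factorial)⁻¹ • MvPowerSeries.X 1 ^ m))
      CoreEnum.coreGF := by
  intro d
  -- The factor `w^m` confines the coefficient of `w^{d 1}` to the terms with `m ≤ d 1`.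
  have hsupp : (Function.support fun m : ℕ => MvPowerSeries.coeff d
      (((2 * m).factorial : ℚ) • CoreEnum.coeffX (2 * m) CoreEnum.coreIntegrand *
          (((2 : ℚ) ^ m * m.factorial)⁻¹ • MvPowerSeries.X 1 ^ m))) ⊆
      ↑(Finset.range (d 1 + 1)) := by
    intro m hm
    rw [Function.mem_support, CoreEnum.eq_expo d, CoreEnum.coeff_summand] at hm
    have : m ≤ d 1 := by
      by_contra h
      exact hm (if_neg h)
    simpa [Nat.lt_succ_iff] using this
  refine ⟨(Finset.finite_toSet _).subset hsupp, ?_⟩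
  rw [finsum_eq_sum_of_support_subset _ hsupp]
  refine Eq.trans (Finset.sum_congr rfl fun m hm => ?_)
    (CoreEnum.sum_coeff_summand (d 0) (d 1))
  rw [CoreEnum.eq_expo d, CoreEnum.coeff_summand]
  exact if_pos (Nat.lt_succ_iff.1 (Finset.mem_range.1 hm))
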